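/- **Definitions.** All alphabets are finite. A *signature* is a pair $\mathcal C=(\Sigma,\mathrm{type})$ with $\Sigma$ an alphabet and $\mathrm{type}:\Sigma\to\mathbb N$. A *hypergraph* $H$ over $\mathcal C$ consists of a finite set $V_H$ of nodes, a finite set $E_H$ of hyperedges, an attachment function $\mathrm{att}_H:E_H\to V_H^*$, a labelling $\mathrm{lab}_H:E_H\to\Sigma$ with $|\mathrm{att}_H(e)|=\mathrm{type}(\mathrm{lab}_H(e))$ for all $e$, and a sequence $\mathrm{ext}_H\in V_H^*$ of external nodes (repetitions are allowed in $\mathrm{att}_H(e)$ and $\mathrm{ext}_H$); put $\mathrm{type}(H)=|\mathrm{ext}_H|$. Isomorphisms are pairs of bijections on nodes and hyperedges preserving attachments, labels and the sequence of external nodes. For $X\in\Sigma$ of type $n$, the handle $X^\bullet$ has distinct nodes $v_1,\dots,v_n$ and one hyperedge, labelled $X$, with attachment $v_1\cdots v_n$, and external nodes $v_1\cdots v_n$. For a string $w=x_1\cdots x_n$ of labels of type $2$, the string graph $w^\bullet$ has distinct nodes $v_0,\dots,v_n$, hyperedges $e_1,\dots,e_n$ with $\mathrm{att}(e_i)=v_{i-1}v_i$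 and $\mathrm{lab}(e_i)=x_i$, and external nodes $v_0v_n$. A *table* over $\mathcal C$ is a finite set $T$ of pairs $(X,R)$, with $X\in\Sigma$ and $R$ a hypergraph over $\mathcal C$ with $\mathrm{type}(R)=\mathrm{type}(X)$, containing at least one pair $(X,R)$ for each $X\in\Sigma$. Write $H\Rrightarrow_T H'$ if one can choose for every $e\in E_H$ a pair $(\mathrm{lab}_H(e),R_e)\in T$ such that $H'$ is isomorphic to the hypergraph obtained from $H$ by deleting all hyperedges, disjointly adding the nodes and hyperedges of $R_e$ for every $e\in E_H$, and identifying the $i$-th external node of $R_e$ with the $i$-th attachment node of $e$ for all $e$ and $i$; the external nodes remain those of $H$. For $k\ge 0$ and $l\ge 1$, a $(k,l)$-*PHR grammar* $\mathcal G=(\mathcal C,A,S,\mathcal T)$ consists of a signature $\mathcal C=(\Sigma,\mathrm{type})$, a set $A\subseteq\Sigma$ of terminal labels, a start symbol $S\in\Sigma$ and a non-empty finite set $\mathcal T$ of at most $l$ tables over $\mathcal C$ such that $\mathrm{type}(X)\le k$ for every rule $(X,R)$ of every table. Its language $\mathrm L(\mathcal G)$ is the set of all hypergraphs $H$ with all labels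 in $A$ such that $H\cong S^\bullet$ or $S^\bullet\Rrightarrow_{T_1}H_1\Rrightarrow_{T_2}\cdots\Rrightarrow_{T_m}H_m=H$ for some $m\ge1$ and $T_1,\dots,T_m\in\mathcal T$. For $k\ge2$, the family $\mathcal{PHRS}_k$ consists of all string languages $L\subseteq A^*$ over finite alphabets $A$ for which there are $l\ge1$ and a $(k,l)$-PHR grammar $\mathcal G$ such that every member of $\mathrm L(\mathcal G)$ is isomorphic to a string graph and $\{w : w^\bullet\in \mathrm L(\mathcal G)\}=L\setminus\{\epsilon\}$. **Theorem (PHRS closed under inverse homomorphisms).** For every $k\ge2$, the family $\mathcal{PHRS}_k$ is closed under inverse homomorphisms: if $A$ and $B$ are finite alphabets, $\varphi:B^*\to A^*$ is a monoid homomorphism and $L\subseteq A^*$ belongs to $\mathcal{PHRS}_k$, then $\varphi^{-1}(L)=\{w\in B^*:\varphi(w)\in L\}$ belongs to $\mathcal{PHRS}_k$. -/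

import Mathlib

namespace PHR

/-- A signature: a finite set of labels, each with an arity, called its type. -/
structure Signature where
  Label : Type
  [finLabel : Finite Label]
  type : Label → ℕ

attribute [instance] Signature.finLabel

/-- A hypergraph over a signature: finitely many nodes and hyperedges, an attachment function,
a labelling function compatible with typing, and a sequence of external nodes. -/
structure Hypergraph (𝒞 : Signature) where
  V : Type
  E : Type
  [finV : Finite V]
  [finE : Finite E]
  att : E → List V
  lab : E → 𝒞.Label
  ext : List V
  length_att : ∀ e, (att e).length = 𝒞.type (lab e)

attribute [instance] Hypergraph.finV Hypergraph.finE

namespace Hypergraph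

variable {𝒞 : Signature}

/-- The type of a hypergraph is the length of its sequence of external nodes. -/
def type (H : Hypergraph 𝒞) : ℕ := H.ext.length

/-- Isomorphism: a bijective, external node reflecting hypergraph morphism. -/
def Iso (G H : Hypergraph 𝒞) : Prop :=
  ∃ (gV : G.V ≃ H.V) (gE : G.E ≃ H.E),
    (∀ e, H.att (gE e) = (G.att e).map gV) ∧
    (∀ e, H.lab (gE e) = G.lab e) ∧
    G.ext.map gV = H.ext

/-- The handle of a label `X`: a single hyperedge labelled `X`, attached to `type X` distinct
nodes, which are also, in the same order, the external nodes. -/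
def handle (X : 𝒞.Label) : Hypergraph 𝒞 where
  V := Fin (𝒞.type X)
  E := Unit
  att _ := List.finRange _
  lab _ := X
  ext := List.finRange _
  length_att _ := List.length_finRange

/-- The string graph of a string `w` of labels of type 2: a directed path with nodes
`v₀, …, vₙ`, whose `i`-th hyperedge carries the `i`-th letter, with external nodes `v₀ vₙ`. -/
def stringGraph (w : List 𝒞.Label) (hw : ∀ x ∈ w, 𝒞.type x = 2) : Hypergraph 𝒞 where
  V := Fin (w.length + 1)
  E := Fin w.length
  att i := [i.castSucc, i.succ]
  lab i := w.get i
  ext := [0, Fin.last _]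
  length_att i := (hw _ (List.get_mem w i)).symm

/-- `H` is a string graph representing `w`. -/
def Represents (H : Hypergraph 𝒞) (w : List 𝒞.Label) : Prop :=
  ∃ hw : ∀ x ∈ w, 𝒞.type x = 2, H.Iso (stringGraph w hw)

/-- The identifications made by a replacement: for every hyperedge `e`, the `i`-th attachment
node of `e` is identified with the `i`-th external node of `σ e`. -/
inductive Glue (H : Hypergraph 𝒞) (σ : H.E → Hypergraph 𝒞) :
    H.V ⊕ (Σ e, (σ e).V) → H.V ⊕ (Σ e, (σ e).V) → Prop
  | glue (e : H.E) (x : H.V) (y : (σ e).V) (h : (x, y) ∈ (H.att e).zip (σ e).ext) :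
      Glue H σ (Sum.inl x) (Sum.inr ⟨e, y⟩)

/-- The replacement of all hyperedges of `H`, each `e` by `σ e` (only used where
`(σ e).type = 𝒞.type (H.lab e)` for all `e`). `Quot` divides by the equivalence relation
generated by `Glue`. -/
def replace (H : Hypergraph 𝒞) (σ : H.E → Hypergraph 𝒞) : Hypergraph 𝒞 where
  V := Quot (Glue H σ)
  E := Σ e, (σ e).E
  att e := ((σ e.1).att e.2).map fun y => Quot.mk _ (Sum.inr ⟨e.1, y⟩)
  lab e := (σ e.1).lab e.2
  ext := H.ext.map fun x => Quot.mk _ (Sum.inl x)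
  length_att e := by simpa using (σ e.1).length_att e.2

end Hypergraph

/-- A table: a finite set of rules `(L, R)` with `type L = type R` that contains at least one
rule for every label `L`. -/
structure Table (𝒞 : Signature) where
  rules : Set (𝒞.Label × Hypergraph 𝒞)
  type_eq : ∀ L R, (L, R) ∈ rules → R.type = 𝒞.type L
  finite : rules.Finite
  total : ∀ L, ∃ R, (L, R) ∈ rules

/-- Parallel direct derivation: every hyperedge is replaced using some rule of the table. -/
def Table.Step {𝒞 : Signature} (T : Table 𝒞) (H H' : Hypergraph 𝒞) : Prop :=
  ∃ σ : H.E → Hypergraph 𝒞, (∀ e, (H.lab e, σ e) ∈ T.rules) ∧ (H.replace σ).Iso H'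

/-- A parallel hyperedge replacement grammar: a signature, a set of terminal labels, a start
symbol, and a non-empty finite indexed set of tables. -/
structure Grammar where
  sig : Signature
  terminals : Set sig.Label
  start : sig.Label
  Index : Type
  [finIndex : Finite Index]
  [nonemptyIndex : Nonempty Index]
  table : Index → Table sig

attribute [instance] Grammar.finIndex Grammar.nonemptyIndex

namespace Grammar

/-- The order is at most `k`: every rule of every table has type at most `k`. -/
def OrderLE (G : Grammar) (k : ℕ) : Prop :=
  ∀ i, ∀ r ∈ (G.table i).rules, G.sig.type r.1 ≤ k

/-- At most `l` tables are used. -/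
def TablesLE (G : Grammar) (l : ℕ) : Prop :=
  (Set.range G.table).ncard ≤ l

/-- Parallel derivation: one or more parallel direct derivations, or an isomorphism. -/
def Derives (G : Grammar) (H H' : Hypergraph G.sig) : Prop :=
  Relation.TransGen (fun H₁ H₂ => ∃ i, (G.table i).Step H₁ H₂) H H' ∨ H.Iso H'

/-- The generated hypergraph language: the terminally labelled hypergraphs derivable from the
handle of the start symbol. -/
def language (G : Grammar) : Set (Hypergraph G.sig) :=
  {H | G.Derives (Hypergraph.handle G.start) H ∧ ∀ e, H.lab e ∈ G.terminals}

/-- The grammar generates a string graph language. -/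
def GeneratesStringGraphs (G : Grammar) : Prop :=
  ∀ H ∈ G.language, ∃ w, H.Represents w

/-- The string language `STR(L(G))`. -/
def stringLanguage (G : Grammar) : Language G.sig.Label :=
  {w | ∃ H ∈ G.language, H.Represents w}

end Grammar

/-- `L` is a parallel hyperedge replacement string language of order `k` with at most `l` tables:
`L` without the empty string is the string language of some grammar of order at most `k` with at
most `l` tables that generates a string graph language. The embedding `ι` regards the letters of
the alphabet of `L` as labels of the grammar. -/
def IsPHRSWith (k l : ℕ) {A : Type*} (L : Language A) : Prop :=
  ∃ (G : Grammar) (ι : A ↪ G.sig.Label),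
    G.OrderLE k ∧ G.TablesLE l ∧ G.GeneratesStringGraphs ∧
    G.stringLanguage = List.map ι '' (L \ {[]})

/-- `L` belongs to the family of `k`-PHRS languages, the union over `l ≥ 1` of the families of
PHRS languages of order `k` with at most `l` tables. -/
def IsPHRS (k : ℕ) {A : Type*} (L : Language A) : Prop :=
  ∃ l ≥ 1, IsPHRSWith k l L

/-- The preimage of a string language under a homomorphism of free monoids. -/
def inverseImage {A B : Type*} (φ : FreeMonoid B →* FreeMonoid A) (L : Language A) :
    Language B :=
  {w | FreeMonoid.toList (φ (FreeMonoid.ofList w)) ∈ L}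

end PHR

/-! ### Isomorphisms, and directed paths with numbered nodes and hyperedges -/

namespace PHR

namespace Hypergraph

variable {𝒞 : Signature}

/-! The homomorphism is inverted by a finite transducer. It reads the image of a word while guessing
the word from left to right; its state is the part of the image of the last guessed letter that is
still to be read, a string of length at most some `M`. Reading a letter X from state r to state r'
while guessing u requires r f(u) = X r'. A run over a string graph puts a state on every node, the
empty string at both ends.

The new grammar derives what the old one derives, with states on the nodes. Only labels can carry
information, so each hyperedge label stores the states of its attachment nodes. The old rules are
decorated with arbitrary states that agree with the label at the external nodes. One additional
table performs all transitions at once, replacing a terminal hyperedge by the string graph of the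
guessed u. Decoration leaves types unchanged and all other new labels have the type of an old label
or type 2, so the order stays at most k.

Tables must be total, so unsuitable labels may always become dead; dead labels persist and are never
terminal. By parallelism, a step of the additional table without dead labels treats all hyperedges
as terminal, hence starts from a member of the old language, which is a string graph.

Letters with empty image may occur in unbounded number. The transducer therefore handles words
without them, and afterwards a letter may be rewritten into one or two letters with the same total
image. If the whole image is empty, the old grammar offers nothing to read; one erased letter is
then derived directly from the start symbol, provided that the empty string belongs to the old
language, which is the proposition `c`.

Soundness is the preservation of `Invariant` (`invariant_of_step`); completeness combines
`exists_run`, `exists_lift_derives` and `Reachable.rewrite`. Both rest on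
`IsPath.represents_replace`. -/

theorem Iso.refl (H : Hypergraph 𝒞) : H.Iso H :=
  ⟨Equiv.refl _, Equiv.refl _, by simp, by simp, by simp⟩

theorem Iso.symm {G H : Hypergraph 𝒞} : G.Iso H → H.Iso G := by
  rintro ⟨gV, gE, hatt, hlab, hext⟩
  refine ⟨gV.symm, gE.symm, fun e => ?_, fun e => ?_, ?_⟩
  · have := hatt (gE.symm e)
    simp only [Equiv.apply_symm_apply] at this
    simp [this]
  · have := hlab (gE.symm e)
    simpa using this.symm
  · simp [← hext]

theorem Iso.trans {G H K : Hypergraph 𝒞} : G.Iso H → H.Iso K → G.Iso K := by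
  rintro ⟨gV, gE, hatt, hlab, hext⟩ ⟨gV', gE', hatt', hlab', hext'⟩
  refine ⟨gV.trans gV', gE.trans gE', fun e => ?_, fun e => ?_, ?_⟩
  · simp [hatt, hatt']
  · simp [hlab, hlab']
  · simp [← hext, ← hext']

theorem Represents.of_iso {G H : Hypergraph 𝒞} {w : List 𝒞.Label} (h : H.Represents w)
    (i : G.Iso H) : G.Represents w :=
  ⟨h.1, i.trans h.2⟩

/-- Replacement does not depend on the representative of the host. -/
theorem Iso.replace {G H : Hypergraph 𝒞} {gV : G.V ≃ H.V} {gE : G.E ≃ H.E}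
    (hatt : ∀ e, H.att (gE e) = (G.att e).map gV) (hext : G.ext.map gV = H.ext)
    (σ : H.E → Hypergraph 𝒞) :
    (G.replace fun e => σ (gE e)).Iso (H.replace σ) := by
  let c : (Σ e, (σ (gE e)).V) ≃ Σ e, (σ e).V := Equiv.sigmaCongrLeft (β := fun e => (σ e).V) gE
  let d : (Σ e, (σ (gE e)).E) ≃ Σ e, (σ e).E := Equiv.sigmaCongrLeft (β := fun e => (σ e).E) gE
  have key : ∀ a b, Glue G (fun e => σ (gE e)) a b ↔
      Glue H σ (Equiv.sumCongr gV c a) (Equiv.sumCongr gV c b) := by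
    intro a b
    constructor
    · rintro ⟨e, x, y, h⟩
      refine Glue.glue (gE e) (gV x) y ?_
      rw [hatt, List.zip_map_left]
      exact List.mem_map.2 ⟨(x, y), h, rfl⟩
    · rcases a with x | ⟨e, y⟩ <;> rcases b with x' | ⟨e', y'⟩
      · rintro ⟨⟩
      · intro h
        have h' : Glue H σ (Sum.inl (gV x)) (Sum.inr ⟨gE e', y'⟩) := h
        rcases h' with ⟨_, _, _, h⟩
        rw [hatt, List.zip_map_left] at h
        obtain ⟨⟨x₁, y₁⟩, h1, h2⟩ := List.mem_map.1 h
        simp only [Prod.map_apply, id_eq, Prod.mk.injEq, EmbeddingLike.apply_eq_iff_eq] at h2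
        obtain ⟨rfl, rfl⟩ := h2
        exact Glue.glue e' _ _ h1
      · rintro ⟨⟩
      · rintro ⟨⟩
  refine ⟨Quot.congr (Equiv.sumCongr gV c) key, d, ?_, ?_, ?_⟩
  · rintro ⟨e, x⟩
    simp only [Hypergraph.replace, List.map_map]
    rfl
  · rintro ⟨e, x⟩
    rfl
  · simp only [Hypergraph.replace, List.map_map, ← hext]
    rfl

/-- `H` is a directed path with `n` hyperedges; `p` and `q` number its nodes and hyperedges. -/
structure IsPath (H : Hypergraph 𝒞) (n : ℕ) (p : H.V → ℕ) (q : H.E → ℕ) : Prop where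
  inj : Function.Injective q
  lt : ∀ e, q e < n
  surj : ∀ i < n, ∃ e, q e = i
  att : ∀ e, ∃ x y, H.att e = [x, y] ∧ p x = q e ∧ p y = q e + 1
  ext : ∃ x y, H.ext = [x, y] ∧ p x = 0 ∧ p y = n
  cover : ∀ z, H.ext.head? = some z ∨ ∃ e x, H.att e = [x, z]

namespace IsPath

variable {H : Hypergraph 𝒞} {n : ℕ} {p : H.V → ℕ} {q : H.E → ℕ}

theorem eq_of_att (h : H.IsPath n p q) {e x y} (he : H.att e = [x, y]) :
    p x = q e ∧ p y = q e + 1 := by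
  obtain ⟨x', y', h1, h2, h3⟩ := h.att e
  rw [he] at h1
  simp only [List.cons.injEq, and_true] at h1
  obtain ⟨rfl, rfl⟩ := h1
  exact ⟨h2, h3⟩

theorem eq_zero_of_head (h : H.IsPath n p q) {z} (hz : H.ext.head? = some z) : p z = 0 := by
  obtain ⟨x, y, h1, h2, -⟩ := h.ext
  rw [h1] at hz
  simp only [List.head?_cons, Option.some.injEq] at hz
  rw [← hz, h2]

/-- By `cover`, a node is the start or the target of a hyperedge; its number then determines that
hyperedge, since `q` is injective. -/
theorem node_injective (h : H.IsPath n p q) : Function.Injective p := by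
  intro z z' hz
  rcases h.cover z with h1 | ⟨e, x, h1⟩ <;> rcases h.cover z' with h2 | ⟨e', x', h2⟩
  · exact Option.some.inj (h1.symm.trans h2)
  · have := h.eq_zero_of_head h1
    have := (h.eq_of_att h2).2
    omega
  · have := h.eq_zero_of_head h2
    have := (h.eq_of_att h1).2
    omega
  · have h3 := (h.eq_of_att h1).2
    have h4 := (h.eq_of_att h2).2
    have : e = e' := h.inj (by omega)
    subst this
    rw [h1] at h2
    simpa using (List.cons.inj h2).2

theorem node_lt (h : H.IsPath n p q) (z) : p z < n + 1 := by
  rcases h.cover z with h1 | ⟨e, x, h1⟩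
  · rw [h.eq_zero_of_head h1]; omega
  · rw [(h.eq_of_att h1).2]
    have := h.lt e
    omega

theorem node_surj (h : H.IsPath n p q) {i : ℕ} (hi : i < n + 1) : ∃ z, p z = i := by
  rcases i with _ | i
  · obtain ⟨x, y, -, h1, -⟩ := h.ext
    exact ⟨x, h1⟩
  · obtain ⟨e, rfl⟩ := h.surj i (by omega)
    obtain ⟨x, y, -, -, h1⟩ := h.att e
    exact ⟨y, h1⟩

theorem represents (h : H.IsPath n p q) {w : List 𝒞.Label} (hw : w.length = n)
    (hlab : ∀ e, w[q e]? = some (H.lab e)) : H.Represents w := by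
  subst hw
  have h2 : ∀ x ∈ w, 𝒞.type x = 2 := by
    intro x hx
    obtain ⟨i, hi, rfl⟩ := List.getElem_of_mem hx
    obtain ⟨e, rfl⟩ := h.surj i hi
    obtain ⟨x, y, h1, -⟩ := h.att e
    have := hlab e
    rw [List.getElem?_eq_getElem hi] at this
    rw [Option.some.inj this, ← H.length_att, h1]
    rfl
  refine ⟨h2, Equiv.ofBijective (fun z => (⟨p z, h.node_lt z⟩ : Fin (w.length + 1))) ⟨?_, ?_⟩,
    Equiv.ofBijective (fun e => (⟨q e, h.lt e⟩ : Fin w.length)) ⟨?_, ?_⟩, ?_, ?_, ?_⟩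
  · intro a b hab
    exact h.node_injective (Fin.mk.inj hab)
  · rintro ⟨i, hi⟩
    obtain ⟨z, hz⟩ := h.node_surj hi
    exact ⟨z, Fin.ext hz⟩
  · intro a b hab
    exact h.inj (Fin.mk.inj hab)
  · rintro ⟨i, hi⟩
    obtain ⟨z, hz⟩ := h.surj i hi
    exact ⟨z, Fin.ext hz⟩
  · intro e
    obtain ⟨x, y, h1, h3, h4⟩ := h.att e
    simp only [stringGraph, h1, List.map_cons, List.map_nil, List.cons.injEq, and_true]
    exact ⟨Fin.ext h3.symm, Fin.ext h4.symm⟩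
  · intro e
    have := hlab e
    rw [List.getElem?_eq_getElem (h.lt e)] at this
    exact Option.some.inj this
  · obtain ⟨x, y, h1, h3, h4⟩ := h.ext
    simp only [stringGraph, h1, List.map_cons, List.map_nil, List.cons.injEq, and_true]
    exact ⟨Fin.ext h3, Fin.ext h4⟩

end IsPath

theorem Represents.exists_isPath {H : Hypergraph 𝒞} {w : List 𝒞.Label} (h : H.Represents w) :
    ∃ p q, H.IsPath w.length p q ∧ ∀ e, w[q e]? = some (H.lab e) := by
  obtain ⟨hw, i⟩ := h
  obtain ⟨gV, gE, hatt, hlab, hext⟩ : ∃ (gV : Fin (w.length + 1) ≃ H.V) (gE : Fin w.length ≃ H.E),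
      (∀ e, H.att (gE e) = [gV e.castSucc, gV e.succ]) ∧ (∀ e, H.lab (gE e) = w.get e) ∧
      [gV 0, gV (Fin.last _)] = H.ext := i.symm
  refine ⟨fun z => gV.symm z, fun e => gE.symm e, ⟨?_, ?_, ?_, ?_, ?_, ?_⟩, ?_⟩
  · intro a b hab
    exact gE.symm.injective (Fin.ext hab)
  · intro e
    exact (gE.symm e).2
  · intro i hi
    exact ⟨gE ⟨i, hi⟩, by simp⟩
  · intro e
    obtain ⟨e, rfl⟩ := gE.surjective e
    refine ⟨_, _, hatt e, ?_, ?_⟩ <;> simp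
  · refine ⟨_, _, hext.symm, ?_, ?_⟩ <;> simp
  · intro z
    obtain ⟨z, rfl⟩ := gV.surjective z
    rw [← hext]
    rcases Fin.eq_zero_or_eq_succ z with rfl | ⟨i, rfl⟩
    · exact Or.inl rfl
    · exact Or.inr ⟨gE i, _, hatt i⟩
  · intro e
    obtain ⟨e, rfl⟩ := gE.surjective e
    rw [hlab]
    simp

theorem represents_stringGraph (w : List 𝒞.Label) (hw : ∀ x ∈ w, 𝒞.type x = 2) :
    (stringGraph w hw).Represents w :=
  ⟨hw, Iso.refl _⟩

end Hypergraph

/-! ### Positions in a concatenation of words -/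

/-- The total length of the first `i` words of a sequence of words. -/
def offset {α : Type*} (U : ℕ → List α) (i : ℕ) : ℕ := ((List.range i).flatMap U).length

section offset

variable {α : Type*} (U : ℕ → List α)

@[simp]
theorem offset_zero : offset U 0 = 0 := by simp [offset]

theorem flatMap_range_succ (i : ℕ) :
    (List.range (i + 1)).flatMap U = (List.range i).flatMap U ++ U i := by
  simp [List.range_succ]

theorem offset_succ (i : ℕ) : offset U (i + 1) = offset U i + (U i).length := by
  simp [offset, flatMap_range_succ]

theorem offset_mono : Monotone (offset U) :=
  monotone_nat_of_le_succ fun i => by rw [offset_succ]; omega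

theorem offset_add_inj {i i' j j' : ℕ} (hj : j < (U i).length) (hj' : j' < (U i').length)
    (h : offset U i + j = offset U i' + j') : i = i' := by
  have h1 := offset_succ U i
  have h2 := offset_succ U i'
  rcases lt_trichotomy i i' with hlt | rfl | hlt
  · have := offset_mono U (show i + 1 ≤ i' from hlt)
    omega
  · rfl
  · have := offset_mono U (show i' + 1 ≤ i from hlt)
    omega

theorem exists_eq_offset_add {n m : ℕ} (h : m < offset U n) :
    ∃ i < n, ∃ j < (U i).length, m = offset U i + j := by
  induction n with
  | zero => simp at h
  | succ n ih =>
    by_cases hm : m < offset U n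
    · obtain ⟨i, hi, h⟩ := ih hm
      exact ⟨i, by omega, h⟩
    · rw [offset_succ] at h
      exact ⟨n, by omega, m - offset U n, by omega, by omega⟩

theorem getElem?_flatMap_range {n i j : ℕ} (hi : i < n) (hj : j < (U i).length) :
    ((List.range n).flatMap U)[offset U i + j]? = (U i)[j]? := by
  induction n with
  | zero => omega
  | succ n ih =>
    rw [flatMap_range_succ]
    rcases Nat.lt_succ_iff_lt_or_eq.1 hi with h | rfl
    · rw [List.getElem?_append_left, ih h]
      have := offset_mono U (show i + 1 ≤ n from h)
      rw [offset_succ] at this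
      change _ < offset U n
      omega
    · rw [List.getElem?_append_right (by change offset U i ≤ _; omega)]
      change (U i)[offset U i + j - offset U i]? = _
      simp

theorem flatMap_range_getD (us : List (List α)) :
    (List.range us.length).flatMap (fun i => us.getD i []) = us.flatten := by
  induction us with
  | nil => simp
  | cons u us ih =>
    rw [List.length_cons, List.range_succ_eq_map, List.flatMap_cons, List.flatMap_map]
    simpa using ih

end offset

/-! ### Replacement in paths and handles -/

namespace Hypergraph

variable {𝒞 : Signature}

/-- Replacing the hyperedges of a path by string graphs gives the string graph of the
concatenated words. -/
theorem IsPath.represents_replace {H : Hypergraph 𝒞} {n : ℕ} {p : H.V → ℕ} {q : H.E → ℕ}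
    (h : H.IsPath n p q) {σ : H.E → Hypergraph 𝒞} {U : ℕ → List 𝒞.Label}
    (hσ : ∀ e, (σ e).Represents (U (q e))) :
    (H.replace σ).Represents ((List.range n).flatMap U) := by
  choose p' q' h' hlab using fun e => (hσ e).exists_isPath
  -- A host node lies where the word of its outgoing hyperedge begins. The glued nodes get equal
  -- numbers by `offset_succ`.
  let P : (H.replace σ).V → ℕ := Quot.lift
    (Sum.elim (fun x => offset U (p x)) fun y => offset U (q y.1) + p' y.1 y.2) (by
      rintro _ _ ⟨e, x, y, hxy⟩
      obtain ⟨x₁, x₂, ha, h1, h2⟩ := h.att e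
      obtain ⟨y₁, y₂, hb, h3, h4⟩ := (h' e).ext
      rw [ha, hb] at hxy
      simp only [List.zip_cons_cons, List.zip_nil_right, List.mem_cons, Prod.mk.injEq,
        List.not_mem_nil, or_false] at hxy
      rcases hxy with ⟨rfl, rfl⟩ | ⟨rfl, rfl⟩
      · simp [h1, h3]
      · simp [h2, h4, offset_succ])
  let Q : (H.replace σ).E → ℕ := fun e => offset U (q e.1) + q' e.1 e.2
  have hmk : ∀ e x y, (x, y) ∈ (H.att e).zip (σ e).ext →
      (Quot.mk _ (Sum.inl x) : (H.replace σ).V) = Quot.mk _ (Sum.inr ⟨e, y⟩) :=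
    fun e x y hxy => Quot.sound (Glue.glue e x y hxy)
  -- The empty word has a string graph with one node, so replacing by it merges the two ends of a
  -- hyperedge. To find an incoming hyperedge one walks back along the host path past such merged
  -- nodes, possibly to its start.
  have cov_inl : ∀ m x, p x = m →
      (H.replace σ).ext.head? = some (Quot.mk _ (Sum.inl x)) ∨
        ∃ e z, (H.replace σ).att e = [z, Quot.mk _ (Sum.inl x)] := by
    intro m
    induction m with
    | zero =>
      intro x hx
      obtain ⟨x₁, x₂, ha, h1, h2⟩ := h.ext
      obtain rfl : x = x₁ := h.node_injective (hx.trans h1.symm)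
      left
      simp [replace, ha]
    | succ m ih =>
      intro x hx
      rcases h.cover x with h1 | ⟨e, x', h1⟩
      · have := h.eq_zero_of_head h1
        omega
      · obtain ⟨y₁, y₂, hb, h3, h4⟩ := (h' e).ext
        have hx' : p x' = m := by
          have := h.eq_of_att h1
          omega
        have e1 := hmk e x' y₁ (by simp [h1, hb])
        have e2 := hmk e x y₂ (by simp [h1, hb])
        rcases (h' e).cover y₂ with h5 | ⟨a, y, h5⟩
        · have h6 : y₁ = y₂ := by simpa [hb] using h5
          rw [e2, ← h6, ← e1]
          exact ih x' hx'
        · right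
          refine ⟨⟨e, a⟩, Quot.mk _ (Sum.inr ⟨e, y⟩), ?_⟩
          rw [e2]
          simp [replace, h5]
  have hpath : (H.replace σ).IsPath (offset U n) P Q := by
    refine ⟨?_, ?_, ?_, ?_, ?_, ?_⟩
    · rintro ⟨e, a⟩ ⟨e', a'⟩ hee
      have := h.inj (offset_add_inj U ((h' e).lt a) ((h' e').lt a') hee)
      subst this
      have : q' e a = q' e a' := Nat.add_left_cancel hee
      rw [(h' e).inj this]
    · rintro ⟨e, a⟩
      have h1 := (h' e).lt a
      have h2 := offset_mono U (show q e + 1 ≤ n from h.lt e)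
      rw [offset_succ] at h2
      change offset U (q e) + q' e a < _
      omega
    · intro m hm
      obtain ⟨i, hi, j, hj, rfl⟩ := exists_eq_offset_add U hm
      obtain ⟨e, rfl⟩ := h.surj i hi
      obtain ⟨a, rfl⟩ := (h' e).surj j hj
      exact ⟨⟨e, a⟩, rfl⟩
    · rintro ⟨e, a⟩
      obtain ⟨x, y, h1, h2, h3⟩ := (h' e).att a
      refine ⟨Quot.mk _ (Sum.inr ⟨e, x⟩), Quot.mk _ (Sum.inr ⟨e, y⟩), by simp [replace, h1],
        ?_, ?_⟩
      · simp [P, Q, h2]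
      · simp [P, Q, h3, add_assoc]
    · obtain ⟨x, y, h1, h2, h3⟩ := h.ext
      refine ⟨Quot.mk _ (Sum.inl x), Quot.mk _ (Sum.inl y), by simp [replace, h1], ?_, ?_⟩
      · simp [P, h2]
      · simp [P, h3]
    · rintro ⟨x | ⟨e, y⟩⟩
      · exact cov_inl _ x rfl
      · rcases (h' e).cover y with h1 | ⟨a, y', h1⟩
        · obtain ⟨y₁, y₂, hb, h3, h4⟩ := (h' e).ext
          obtain ⟨x₁, x₂, ha, -⟩ := h.att e
          have h6 : y₁ = y := by simpa [hb] using h1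
          have e1 := hmk e x₁ y (by simp [ha, hb, h6])
          have := cov_inl _ x₁ rfl
          rw [e1] at this
          exact this
        · exact Or.inr ⟨⟨e, a⟩, Quot.mk _ (Sum.inr ⟨e, y'⟩), by simp [replace, h1]⟩
  refine hpath.represents rfl ?_
  rintro ⟨e, a⟩
  change ((List.range n).flatMap U)[offset U (q e) + q' e a]? = some ((σ e).lab a)
  rw [getElem?_flatMap_range U (h.lt e) ((h' e).lt a), hlab]

/-- The replacement of a handle is the replacing hypergraph. -/
theorem replace_handle_iso (X : 𝒞.Label) (R : Hypergraph 𝒞) (hR : R.type = 𝒞.type X) :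
    ((handle X).replace fun _ => R).Iso R := by
  have hlen : R.ext.length = 𝒞.type X := hR
  let F : ((handle X).replace fun _ => R).V → R.V := Quot.lift
    (Sum.elim (fun i : Fin (𝒞.type X) => R.ext[i.1]'(by omega)) fun y => y.2) (by
      rintro _ _ ⟨e, i, y, hxy⟩
      obtain ⟨j, hj, h1⟩ := List.getElem_of_mem hxy
      simp only [handle, List.getElem_zip, List.getElem_finRange] at h1
      obtain ⟨rfl, rfl⟩ := h1
      rfl)
  have hmk : ∀ (i : Fin (𝒞.type X)),
      (Quot.mk _ (Sum.inl i) : ((handle X).replace fun _ => R).V) =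
        Quot.mk _ (Sum.inr ⟨(), R.ext[i.1]'(by omega)⟩) := by
    intro i
    refine Quot.sound (Glue.glue _ _ _ ?_)
    refine List.mem_iff_getElem.2 ⟨i.1, ?_, ?_⟩
    · simp [handle, hlen]
    · simp [handle]
  have hF : ∀ z, (Quot.mk _ (Sum.inr ⟨(), F z⟩) : ((handle X).replace fun _ => R).V) = z := by
    rintro ⟨i | ⟨⟨⟩, y⟩⟩
    · exact (hmk i).symm
    · rfl
  refine ⟨⟨F, fun y => Quot.mk _ (Sum.inr ⟨(), y⟩), hF, fun y => rfl⟩,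
    ⟨fun e => e.2, fun e => ⟨(), e⟩, fun e => rfl, fun e => rfl⟩, ?_, ?_, ?_⟩
  · rintro ⟨⟨⟩, e⟩
    simp only [replace, List.map_map]
    exact (List.map_id _).symm
  · rintro ⟨⟨⟩, e⟩
    rfl
  · simp only [replace, handle, List.map_map]
    refine List.ext_getElem (by simp [hlen]) fun i h1 h2 => ?_
    simp only [List.getElem_map, List.getElem_finRange]
    rfl

end Hypergraph

open PHR.Hypergraph

namespace Table

variable {𝒞 : Signature} {T : Table 𝒞}

theorem Step.of_iso_left {H H' K : Hypergraph 𝒞} (h : T.Step H K) (i : H'.Iso H) :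
    T.Step H' K := by
  obtain ⟨σ, hσ, j⟩ := h
  obtain ⟨gV, gE, hatt, hlab, hext⟩ := i
  exact ⟨fun e => σ (gE e), fun e => hlab e ▸ hσ (gE e), (Iso.replace hatt hext σ).trans j⟩

theorem step_handle {X : 𝒞.Label} {R : Hypergraph 𝒞} (h : (X, R) ∈ T.rules) :
    T.Step (handle X) R :=
  ⟨fun _ => R, fun _ => h, replace_handle_iso X R (T.type_eq _ _ h)⟩

theorem Step.exists_of_handle {X : 𝒞.Label} {K : Hypergraph 𝒞} (h : T.Step (handle X) K) :
    ∃ R, (X, R) ∈ T.rules ∧ R.Iso K := by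
  obtain ⟨σ, hσ, j⟩ := h
  exact ⟨σ (), hσ (), (replace_handle_iso X _ (T.type_eq _ _ (hσ ()))).symm.trans j⟩

end Table

end PHR

/-! ### The grammar that simulates the transducer -/

namespace PHR

open PHR.Hypergraph

namespace Grammar

variable (G : Grammar) (B : Type) (M : ℕ)

/-- The states of the transducer inverting a homomorphism: bounded strings of letters that still
have to be read. -/
abbrev Pending : Type := {l : List G.sig.Label // l.length ≤ M}

instance : Finite (G.Pending M) := (List.finite_length_le G.sig.Label M).to_subtype

/-- The labels of the grammar for the preimage under a homomorphism. -/
inductive InvLabel : Type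
  | start
  | dead (X : Option G.sig.Label)
  | state (X : G.sig.Label) (s : List.Vector (G.Pending M) (G.sig.type X))
  | letter (b : B)

instance [Finite B] : Finite (G.InvLabel B M) := by
  let F : (Unit ⊕ Option G.sig.Label) ⊕
      (Σ X : G.sig.Label, List.Vector (G.Pending M) (G.sig.type X)) ⊕ B → G.InvLabel B M :=
    Sum.elim (Sum.elim (fun _ => .start) .dead) (Sum.elim (fun x => .state x.1 x.2) .letter)
  have (n : ℕ) : Finite (List.Vector (G.Pending M) n) :=
    Finite.of_equiv _ (Equiv.vectorEquivFin (G.Pending M) n).symm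
  refine Finite.of_surjective F ?_
  rintro (_ | X | ⟨X, s⟩ | b)
  · exact ⟨.inl (.inl ()), rfl⟩
  · exact ⟨.inl (.inr X), rfl⟩
  · exact ⟨.inr (.inl ⟨X, s⟩), rfl⟩
  · exact ⟨.inr (.inr b), rfl⟩

/-- The types of the labels of the grammar for the preimage. -/
def InvLabel.type {G : Grammar} {B : Type} {M : ℕ} : G.InvLabel B M → ℕ
  | start => 2
  | dead none => 2
  | dead (some X) => G.sig.type X
  | state X _ => G.sig.type X
  | letter _ => 2

/-- The signature of the grammar for the preimage. -/
def invSig [Finite B] : Signature where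
  Label := G.InvLabel B M
  type := InvLabel.type

variable {G B M}

theorem InvLabel.state_eq {X Y : G.sig.Label} {s : List.Vector (G.Pending M) (G.sig.type X)}
    {t : List.Vector (G.Pending M) (G.sig.type Y)} (h : X = Y) (hs : s.toList = t.toList) :
    (InvLabel.state X s : G.InvLabel B M) = .state Y t := by
  subst h
  rw [List.Vector.eq s t hs]

variable [Finite B]

variable (B) in
/-- A hypergraph whose nodes carry states, as a hypergraph over the new signature. -/
def decorate (H : Hypergraph G.sig) (s : H.V → G.Pending M) : Hypergraph (G.invSig B M) where
  V := H.V
  E := H.E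
  att := H.att
  lab e := .state (H.lab e) ⟨(H.att e).map s, by rw [List.length_map, H.length_att]⟩
  ext := H.ext
  length_att e := H.length_att e

/-- A letter of the new alphabet, as a label. -/
def invLetter (G : Grammar) (M : ℕ) (b : B) : (G.invSig B M).Label := InvLabel.letter b

/-- The string graph of a string of letters of the new alphabet. -/
def wordGraph (G : Grammar) (M : ℕ) (u : List B) : Hypergraph (G.invSig B M) :=
  stringGraph (u.map (invLetter G M)) (by
    intro x hx
    obtain ⟨b, -, rfl⟩ := List.mem_map.1 hx
    rfl)

theorem represents_wordGraph (u : List B) :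
    (wordGraph G M u).Represents (u.map (invLetter G M)) :=
  represents_stringGraph _ _

theorem decorate_iso {H K : Hypergraph G.sig} {gV : H.V ≃ K.V} {gE : H.E ≃ K.E}
    (hatt : ∀ e, K.att (gE e) = (H.att e).map gV) (hlab : ∀ e, K.lab (gE e) = H.lab e)
    (hext : H.ext.map gV = K.ext) (s : K.V → G.Pending M) :
    (decorate B H fun x => s (gV x)).Iso (decorate B K s) := by
  refine ⟨gV, gE, hatt, fun e => InvLabel.state_eq (hlab e) ?_, hext⟩
  exact (congrArg (List.map s) (hatt e)).trans List.map_map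

/-- Decoration commutes with replacement. -/
theorem replace_decorate_iso {H : Hypergraph G.sig} {σ : H.E → Hypergraph G.sig}
    (s : (H.replace σ).V → G.Pending M) :
    ((decorate B H fun x => s (Quot.mk _ (Sum.inl x))).replace fun e : H.E =>
        decorate B (σ e) fun y => s (Quot.mk _ (Sum.inr ⟨e, y⟩))).Iso
      (decorate B (H.replace σ) s) := by
  refine ⟨Quot.congr (Equiv.refl _) ?_, Equiv.refl _, ?_, ?_, ?_⟩
  · rintro a b
    constructor
    · rintro ⟨e, x, y, h⟩
      exact Glue.glue (H := H) e x y h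
    · intro h
      have h' : Glue H σ a b := h
      rcases a with x | z <;> rcases b with x' | ⟨e, y⟩
      · rcases h'
      · rcases h' with ⟨_, _, _, h⟩
        exact Glue.glue _ _ _ h
      · rcases h'
      · rcases h'
  · rintro ⟨e, a⟩
    simp only [replace, List.map_map]
    rfl
  · rintro ⟨e, a⟩
    refine InvLabel.state_eq rfl ?_
    exact List.map_map (l := (σ e).att a)
  · simp only [replace, List.map_map]
    rfl

section rules

variable (f : B → List G.sig.Label) (c : Prop)

/-- The rules common to all tables. Letters may be surrounded by erased letters. -/
inductive CommonRule : G.InvLabel B M → Hypergraph (G.invSig B M) → Prop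
  | start_dead : CommonRule .start (handle (𝒞 := G.invSig B M) (.dead none))
  | start_state (s : List.Vector (G.Pending M) (G.sig.type G.start))
      (hs : s.toList.map Subtype.val = [[], []]) :
      CommonRule .start (handle (𝒞 := G.invSig B M) (.state G.start s))
  | start_letter (b : B) (hc : c) (hb : f b = []) : CommonRule .start (wordGraph G M [b])
  | dead (X) : CommonRule (.dead X) (handle (𝒞 := G.invSig B M) (.dead X))
  | state (X s) : CommonRule (.state X s) (handle (𝒞 := G.invSig B M) (.dead (some X)))
  | letter (b : B) (u : List B) (h0 : u ≠ []) (h2 : u.length ≤ 2) (hu : u.flatMap f = f b) :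
      CommonRule (.letter b) (wordGraph G M u)

/-- The common rules and the rules of a given table, decorated by states. -/
inductive LiftRule (T : Table G.sig) : G.InvLabel B M → Hypergraph (G.invSig B M) → Prop
  | common {X R} (h : CommonRule f c X R) : LiftRule T X R
  | lift (X s) (R : Hypergraph G.sig) (t : R.V → G.Pending M) (h : (X, R) ∈ T.rules)
      (hs : s.toList = R.ext.map t) : LiftRule T (.state X s) (decorate B R t)

/-- The common rules and the rules performing the transitions of the transducer. -/
inductive FinalRule : G.InvLabel B M → Hypergraph (G.invSig B M) → Prop
  | common {X R} (h : CommonRule f c X R) : FinalRule X R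
  | final (X s) (r r' : G.Pending M) (u : List B) (hX : X ∈ G.terminals)
      (hs : s.toList = [r, r']) (h1 : u.length ≤ 1) (hu : r.1 ++ u.flatMap f = X :: r'.1) :
      FinalRule (.state X s) (wordGraph G M u)

variable {f c}

theorem CommonRule.type_eq {X R} (h : CommonRule (M := M) f c X R) :
    R.type = (G.invSig B M).type X := by
  have hh (Y : G.InvLabel B M) : (handle (𝒞 := G.invSig B M) Y).type = Y.type :=
    List.length_finRange
  cases h with
  | start_state s hs =>
    rw [hh]
    have := congrArg List.length hs
    rw [List.length_map, List.Vector.toList_length] at this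
    exact this
  | start_dead => exact hh _
  | start_letter => rfl
  | dead X => exact hh _
  | state X s => exact hh _
  | letter => rfl

theorem LiftRule.type_eq {T : Table G.sig} {X R} (h : LiftRule (M := M) f c T X R) :
    R.type = (G.invSig B M).type X := by
  cases h with
  | common h => exact h.type_eq
  | lift X s R t h hs => exact T.type_eq X R h

theorem FinalRule.type_eq {X R} (h : FinalRule (M := M) f c X R) :
    R.type = (G.invSig B M).type X := by
  cases h with
  | common h => exact h.type_eq
  | final X s r r' u hX hs h1 hu =>
    have := congrArg List.length hs
    rw [List.Vector.toList_length] at this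
    exact this.symm

theorem exists_commonRule (X : G.InvLabel B M) : ∃ R, CommonRule f c X R := by
  rcases X with _ | X | ⟨X, s⟩ | b
  · exact ⟨_, .start_dead⟩
  · exact ⟨_, .dead X⟩
  · exact ⟨_, .state X s⟩
  · exact ⟨_, .letter b [b] (by simp) (by simp) (by simp)⟩

variable (f c) in
theorem finite_commonRule :
    {r : G.InvLabel B M × Hypergraph (G.invSig B M) |
      CommonRule (M := M) f c r.1 r.2}.Finite := by
  have h1 := Set.finite_range fun x : (G.InvLabel B M × G.InvLabel B M) =>
    (x.1, handle (𝒞 := G.invSig B M) x.2)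
  have h2 := ((Set.toFinite (Set.univ : Set (G.InvLabel B M))).prod
    (List.finite_length_le B 2)).image fun x => (x.1, wordGraph G M x.2)
  refine (h1.union h2).subset ?_
  rintro ⟨X, R⟩ (h | ⟨s, hs⟩ | ⟨b, hc, hb⟩ | X | ⟨X, s⟩ | ⟨b, u, h0, h2, hu⟩)
  · exact .inl ⟨(_, _), rfl⟩
  · exact .inl ⟨(_, _), rfl⟩
  · exact .inr ⟨(_, [b]), ⟨trivial, by simp⟩, rfl⟩
  · exact .inl ⟨(_, _), rfl⟩
  · exact .inl ⟨(_, _), rfl⟩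
  · exact .inr ⟨(_, u), ⟨trivial, h2⟩, rfl⟩

variable (f c) in
theorem finite_liftRule (T : Table G.sig) :
    {r : G.InvLabel B M × Hypergraph (G.invSig B M) |
      LiftRule (M := M) f c T r.1 r.2}.Finite := by
  have := T.finite.to_subtype
  have h1 := Set.finite_range
    fun x : (G.InvLabel B M × Σ r : T.rules, (r.1.2.V → G.Pending M)) =>
    (x.1, decorate B x.2.1.1.2 x.2.2)
  refine ((finite_commonRule f c).union h1).subset ?_
  rintro ⟨X, R⟩ (h | ⟨X, s, R, t, h, hs⟩)
  · exact .inl h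
  · exact .inr ⟨(_, ⟨⟨_, h⟩, t⟩), rfl⟩

variable (f c) in
theorem finite_finalRule :
    {r : G.InvLabel B M × Hypergraph (G.invSig B M) |
      FinalRule (M := M) f c r.1 r.2}.Finite := by
  have h2 := ((Set.toFinite (Set.univ : Set (G.InvLabel B M))).prod
    (List.finite_length_le B 1)).image fun x => (x.1, wordGraph G M x.2)
  refine ((finite_commonRule f c).union h2).subset ?_
  rintro ⟨X, R⟩ (h | ⟨X, s, r, r', u, hX, hs, h1, hu⟩)
  · exact .inl h
  · exact .inr ⟨(_, u), ⟨trivial, h1⟩, rfl⟩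

end rules

variable (G M) in
/-- The grammar generating the preimage, under the homomorphism given by `f`, of the language of
`G`, and the erased strings if `c` holds. -/
def invGrammar (f : B → List G.sig.Label) (c : Prop) : Grammar where
  sig := G.invSig B M
  terminals := Set.range (invLetter G M)
  start := InvLabel.start
  Index := Option G.Index
  table i := i.elim
    ⟨{r : G.InvLabel B M × Hypergraph (G.invSig B M) |
        FinalRule (M := M) f c r.1 r.2}, fun _ _ h => FinalRule.type_eq h,
      finite_finalRule f c, fun X => (exists_commonRule X).imp fun _ h => .common h⟩
    fun i => ⟨{r : G.InvLabel B M × Hypergraph (G.invSig B M) |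
        LiftRule (M := M) f c (G.table i) r.1 r.2}, fun _ _ h => LiftRule.type_eq h,
      finite_liftRule f c _, fun X => (exists_commonRule X).imp fun _ h => .common h⟩

end Grammar

end PHR

/-! ### Soundness: an invariant of all derivations -/

namespace PHR

open PHR.Hypergraph

theorem eq_of_mem_zip_of_map_eq {α β γ : Type*} {f : α → γ} {g : β → γ} {l : List α} {m : List β}
    (h : l.map f = m.map g) {x : α} {y : β} (hxy : (x, y) ∈ l.zip m) : f x = g y := by
  induction l generalizing m with
  | nil => simp at hxy
  | cons a l ih =>
    cases m with
    | nil => simp at hxy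
    | cons b m =>
      simp only [List.map_cons, List.cons.injEq] at h
      simp only [List.zip_cons_cons, List.mem_cons, Prod.mk.injEq] at hxy
      rcases hxy with ⟨rfl, rfl⟩ | hxy
      · exact h.1
      · exact ih h.2 hxy

theorem flatMap_range_eq {α β : Type*} {f : α → List β} {w : List α} {g : ℕ → List β}
    (h : ∀ i a, w[i]? = some a → g i = f a) : (List.range w.length).flatMap g = w.flatMap f := by
  induction w generalizing g with
  | nil => simp
  | cons a w ih =>
    rw [List.length_cons, List.range_succ_eq_map, List.flatMap_cons, List.flatMap_map,
      List.flatMap_cons, h 0 a rfl]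
    congr 1
    exact ih fun i b hb => h (i + 1) b hb

namespace Grammar

variable {G : Grammar} {B : Type} {M : ℕ} [Finite B] {f : B → List G.sig.Label} {c : Prop}

variable (f c) in
/-- The nonempty strings in the preimage of the language of `G`, and the nonempty erased strings
if `c` holds. -/
def invTarget : Set (List B) :=
  {w | w ≠ [] ∧ (w.flatMap f ∈ G.stringLanguage ∨ c ∧ w.flatMap f = [])}

variable (M f c) in
/-- The hypergraphs with a hyperedge carrying a dead label, the decorated hypergraphs derivable
in `G`, and the string graphs in the target language. -/
def Invariant (H : Hypergraph (G.invSig B M)) : Prop :=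
  (∃ e X, H.lab e = .dead X) ∨
  (∃ (H₀ : Hypergraph G.sig) (s : H₀.V → G.Pending M), G.Derives (handle G.start) H₀ ∧
    H.Iso (decorate B H₀ s) ∧ (H₀.ext.map s).map Subtype.val = [[], []]) ∨
  ∃ w ∈ invTarget f c, H.Represents (w.map (invLetter G M))

variable (M f c) in
/-- One parallel direct derivation with any table of the new grammar. -/
def InvStep (H K : Hypergraph (G.invSig B M)) : Prop :=
  ∃ i, ((G.invGrammar M f c).table i).Step H K

theorem InvStep.of_iso_left {H H' K : Hypergraph (G.invSig B M)} (h : InvStep M f c H K)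
    (i : H'.Iso H) : InvStep M f c H' K :=
  h.imp fun _ h => h.of_iso_left i

theorem commonRule_of_mem {i : Option G.Index} {X : G.InvLabel B M}
    {R : Hypergraph (G.invSig B M)} (h : (X, R) ∈ ((G.invGrammar M f c).table i).rules)
    (hX : ∀ Y s, X ≠ .state Y s) : CommonRule f c X R := by
  cases i with
  | none =>
    have h' : FinalRule f c X R := h
    cases h' with
    | common h => exact h
    | final => exact absurd rfl (hX _ _)
  | some i =>
    have h' : LiftRule f c (G.table i) X R := h
    cases h' with
    | common h => exact h
    | lift => exact absurd rfl (hX _ _)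

theorem mem_rules_of_commonRule {X : G.InvLabel B M} {R : Hypergraph (G.invSig B M)}
    (h : CommonRule f c X R) (i : Option G.Index) :
    (X, R) ∈ ((G.invGrammar M f c).table i).rules := by
  cases i with
  | none => exact FinalRule.common h
  | some i => exact LiftRule.common h

theorem exists_dead_of_replace {H K : Hypergraph (G.invSig B M)}
    {σ : H.E → Hypergraph (G.invSig B M)} (i : (H.replace σ).Iso K) {e : H.E} {a : (σ e).E} {X}
    (ha : (σ e).lab a = .dead X) : ∃ e X, K.lab e = .dead X := by
  obtain ⟨gV, gE, -, hlab, -⟩ := i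
  exact ⟨gE ⟨e, a⟩, X, (hlab _).trans ha⟩

theorem exists_dead_of_step {H K : Hypergraph (G.invSig B M)} {e X} (he : H.lab e = .dead X)
    (h : InvStep M f c H K) : ∃ e X, K.lab e = .dead X := by
  obtain ⟨i, σ, hσ, j⟩ := h
  have h1 : CommonRule f c (.dead X) (σ e) := commonRule_of_mem (he ▸ hσ e) (by simp)
  have h2 : ∃ a, (σ e).lab a = .dead X := by
    generalize σ e = R at h1
    cases h1
    exact ⟨(), rfl⟩
  obtain ⟨a, ha⟩ := h2
  exact exists_dead_of_replace j ha

/-- A state label escapes death under such a table only by a decorated rule. Forgetting the states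
then gives a step of the old grammar. -/
theorem invariant_of_lift {i : G.Index} {H₀ : Hypergraph G.sig} {s : H₀.V → G.Pending M}
    {K : Hypergraph (G.invSig B M)} (hd : G.Derives (handle G.start) H₀)
    (hext : (H₀.ext.map s).map Subtype.val = [[], []])
    (h : ((G.invGrammar M f c).table (some i)).Step (decorate B H₀ s) K) :
    Invariant M f c K := by
  obtain ⟨σ, hσ, j⟩ := h
  by_cases hdead : ∃ e a X, (σ e).lab a = .dead X
  · obtain ⟨e, a, X, ha⟩ := hdead
    exact .inl (exists_dead_of_replace j ha)
  have key : ∀ e : H₀.E, ∃ (R : Hypergraph G.sig) (t : R.V → G.Pending M),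
      (H₀.lab e, R) ∈ (G.table i).rules ∧ (H₀.att e).map s = R.ext.map t ∧
      σ e = decorate B R t := by
    intro e
    have h1 : LiftRule f c (G.table i) ((decorate B H₀ s).lab e) (σ e) := hσ e
    have h2 : ∀ a X, (σ e).lab a ≠ .dead X := fun a X ha => hdead ⟨e, a, X, ha⟩
    generalize σ e = R at h1 h2
    cases h1 with
    | common h1 => cases h1; exact absurd rfl (h2 () _)
    | lift X s R t h hs => exact ⟨R, t, h, hs, rfl⟩
  choose R t hR ht hσ' using key
  obtain rfl : σ = fun e => decorate B (R e) (t e) := funext hσ'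
  -- The states descend to the glued nodes because a decorated rule agrees with the label of its
  -- hyperedge at the external nodes.
  let s' : (H₀.replace R).V → G.Pending M := Quot.lift (Sum.elim s fun y => t y.1 y.2) (by
    rintro _ _ ⟨e, x, y, hxy⟩
    exact eq_of_mem_zip_of_map_eq (ht e) hxy)
  refine .inr (.inl ⟨H₀.replace R, s', ?_, ?_, ?_⟩)
  · have h1 : (G.table i).Step H₀ (H₀.replace R) := ⟨R, hR, Iso.refl _⟩
    left
    rcases hd with hd | hd
    · exact hd.tail ⟨i, h1⟩
    · exact .single ⟨i, h1.of_iso_left hd⟩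
  · exact j.symm.trans (replace_decorate_iso s')
  · rw [← hext]
    exact congrArg _ (List.map_map (l := H₀.ext))

/-- Without dead labels every hyperedge makes a transition, so all old labels are terminal and the
old hypergraph is a string graph. The transitions along it compose to a run from the empty state to
the empty state. -/
theorem invariant_of_final (hG : G.GeneratesStringGraphs) (hnil : [] ∉ G.stringLanguage)
    {H₀ : Hypergraph G.sig} {s : H₀.V → G.Pending M}
    {K : Hypergraph (G.invSig B M)} (hd : G.Derives (handle G.start) H₀)
    (hext : (H₀.ext.map s).map Subtype.val = [[], []])
    (h : ((G.invGrammar M f c).table none).Step (decorate B H₀ s) K) :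
    Invariant M f c K := by
  obtain ⟨σ, hσ, j⟩ := h
  by_cases hdead : ∃ e a X, (σ e).lab a = .dead X
  · obtain ⟨e, a, X, ha⟩ := hdead
    exact .inl (exists_dead_of_replace j ha)
  have key : ∀ e : H₀.E, ∃ u : List B, H₀.lab e ∈ G.terminals ∧
      (∃ r r' : G.Pending M, (H₀.att e).map s = [r, r'] ∧
        r.1 ++ u.flatMap f = H₀.lab e :: r'.1) ∧ σ e = wordGraph G M u := by
    intro e
    have h1 : FinalRule f c ((decorate B H₀ s).lab e) (σ e) := hσ e
    have h2 : ∀ a X, (σ e).lab a ≠ .dead X := fun a X ha => hdead ⟨e, a, X, ha⟩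
    generalize σ e = R at h1 h2
    cases h1 with
    | common h1 => cases h1; exact absurd rfl (h2 () _)
    | final X s r r' u hX hs h1 hu => exact ⟨u, hX, ⟨r, r', hs, hu⟩, rfl⟩
  choose u hu hr hσ' using key
  have hH₀ : H₀ ∈ G.language := ⟨hd, hu⟩
  obtain ⟨w, hw⟩ := hG H₀ hH₀
  have hwG : w ∈ G.stringLanguage := ⟨H₀, hH₀, hw⟩
  obtain ⟨p, q, hp, hlab⟩ := hw.exists_isPath
  -- Guessed words and states are indexed by position along the path; the default value is never met
  -- within the path.
  let U : ℕ → List B := Function.extend q u fun _ => []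
  let r : ℕ → List G.sig.Label := Function.extend p (fun x => (s x).1) fun _ => []
  have hU : ∀ e, U (q e) = u e := fun e => hp.inj.extend_apply _ _ e
  have hrp : ∀ x, r (p x) = (s x).1 := fun x => hp.node_injective.extend_apply _ _ x
  obtain ⟨x₀, x₁, hx, hx₀, hx₁⟩ := hp.ext
  rw [hx] at hext
  simp only [List.map_cons, List.map_nil, List.cons.injEq, and_true] at hext
  -- What has been guessed so far maps to what has been read so far, followed by the pending string.
  have hrun : ∀ i ≤ w.length,
      ((List.range i).flatMap U).flatMap f = w.take i ++ r i := by
    intro i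
    induction i with
    | zero =>
      intro _
      have : r 0 = [] := by rw [← hx₀, hrp, hext.1]
      simp [this]
    | succ i ih =>
      intro hi
      obtain ⟨e, rfl⟩ := hp.surj i hi
      obtain ⟨x, y, ha, hxe, hye⟩ := hp.att e
      obtain ⟨r₁, r₂, h1, h2⟩ := hr e
      rw [ha] at h1
      simp only [List.map_cons, List.map_nil, List.cons.injEq, and_true] at h1
      obtain ⟨rfl, rfl⟩ := h1
      rw [flatMap_range_succ, List.flatMap_append, ih (by omega), hU, ← hxe, hrp,
        List.append_assoc, h2, hxe, ← hye, hrp, hye, List.take_add_one, hlab]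
      simp
  have himg : ((List.range w.length).flatMap U).flatMap f = w := by
    rw [hrun _ le_rfl, ← hx₁, hrp, hext.2, hx₁]
    simp
  refine .inr (.inr ⟨(List.range w.length).flatMap U, ⟨?_, ?_⟩, ?_⟩)
  · intro h0
    rw [h0] at himg
    exact hnil (by simpa [← himg] using hwG)
  · left
    rwa [himg]
  · have hp' : (decorate B H₀ s).IsPath w.length p q :=
      ⟨hp.inj, hp.lt, hp.surj, hp.att, hp.ext, hp.cover⟩
    rw [List.map_flatMap]
    have hσU : ∀ e : H₀.E, (σ e).Represents ((U (q e)).map (invLetter G M)) := by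
      intro e
      rw [hσ' e, hU]
      exact represents_wordGraph _
    exact Represents.of_iso
      (hp'.represents_replace (U := fun i => (U i).map (invLetter G M)) hσU) j.symm

/-- Rewriting a letter preserves its image, and since its replacement is nonempty, the word stays
nonempty. -/
theorem invariant_of_word {w : List B} (hw : w ∈ invTarget f c)
    {H K : Hypergraph (G.invSig B M)} (hH : H.Represents (w.map (invLetter G M)))
    (h : InvStep M f c H K) : Invariant M f c K := by
  obtain ⟨i, σ, hσ, j⟩ := h
  obtain ⟨p, q, hp, hlab⟩ := hH.exists_isPath
  rw [List.length_map] at hp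
  have key : ∀ e : H.E, ∃ b u, w[q e]? = some b ∧ u ≠ [] ∧ u.flatMap f = f b ∧
      σ e = wordGraph G M u := by
    intro e
    have h1 := hlab e
    rw [List.getElem?_map] at h1
    obtain ⟨b, hb, hbe⟩ := Option.map_eq_some_iff.1 h1
    have h2 : CommonRule f c (.letter b) (σ e) := commonRule_of_mem (hbe ▸ hσ e) (by simp)
    generalize σ e = R at h2
    cases h2 with
    | letter _ u h0 h2 hu => exact ⟨b, u, hb, h0, hu, rfl⟩
  choose b u hb hu0 huf hσ' using key
  let U : ℕ → List B := Function.extend q u fun _ => []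
  have hU : ∀ e, U (q e) = u e := fun e => hp.inj.extend_apply _ _ e
  refine .inr (.inr ⟨(List.range w.length).flatMap U, ⟨?_, ?_⟩, ?_⟩)
  · intro h0
    obtain ⟨e, he⟩ := hp.surj 0 (List.length_pos_iff.2 hw.1)
    have := List.flatMap_eq_nil_iff.1 h0 (q e) (List.mem_range.2 (hp.lt e))
    rw [hU] at this
    exact hu0 e this
  · have : ((List.range w.length).flatMap U).flatMap f = w.flatMap f := by
      rw [List.flatMap_assoc]
      refine flatMap_range_eq fun i a ha => ?_
      obtain ⟨e, rfl⟩ := hp.surj i (List.getElem?_eq_some_iff.1 ha).1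
      rw [hU, huf, Option.some.inj ((hb e).symm.trans ha)]
    rw [this]
    exact hw.2
  · rw [List.map_flatMap]
    refine Represents.of_iso (hp.represents_replace (U := fun i => (U i).map (invLetter G M))
      fun e => ?_) j.symm
    rw [hσ' e, hU]
    exact represents_wordGraph _

theorem invariant_of_step (hG : G.GeneratesStringGraphs) (hnil : [] ∉ G.stringLanguage)
    {H K : Hypergraph (G.invSig B M)} (hH : Invariant M f c H) (h : InvStep M f c H K) :
    Invariant M f c K := by
  rcases hH with ⟨e, X, he⟩ | ⟨H₀, s, hd, i, hext⟩ | ⟨w, hw, hH⟩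
  · exact .inl (exists_dead_of_step he h)
  · obtain ⟨t, h⟩ := h.of_iso_left i.symm
    cases t with
    | none => exact invariant_of_final hG hnil hd hext h
    | some t => exact invariant_of_lift hd hext h
  · exact invariant_of_word hw hH h

/-- The handle of a state label is a decorated handle. -/
theorem handle_state_iso (X : G.sig.Label) (s : List.Vector (G.Pending M) (G.sig.type X)) :
    (handle (𝒞 := G.invSig B M) (.state X s)).Iso (decorate B (handle X) s.get) := by
  refine ⟨Equiv.refl _, Equiv.refl _, fun e => (List.map_id _).symm,
    fun e => InvLabel.state_eq rfl ?_, List.map_id _⟩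
  refine List.ext_getElem ?_ fun i h1 h2 => ?_
  · simp [handle]
  · simp [handle, List.Vector.get_eq_get_toList]

theorem invariant_of_start {K : Hypergraph (G.invSig B M)}
    (h : InvStep M f c (handle (𝒞 := G.invSig B M) .start) K) : Invariant M f c K := by
  obtain ⟨i, h⟩ := h
  obtain ⟨R, hR, j⟩ := h.exists_of_handle
  have hR' : CommonRule f c .start R := commonRule_of_mem hR (by simp)
  cases hR' with
  | start_dead =>
    obtain ⟨gV, gE, -, hlab, -⟩ := j
    exact .inl ⟨gE (), none, hlab _⟩
  | start_state s hs =>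
    refine .inr (.inl ⟨_, s.get, .inr (Iso.refl _), j.symm.trans (handle_state_iso _ s), ?_⟩)
    rw [← hs]
    congr 1
    refine List.ext_getElem ?_ fun i h1 h2 => ?_
    · simp [handle]
    · simp [handle, List.Vector.get_eq_get_toList]
  | start_letter b hc hb =>
    exact .inr (.inr ⟨[b], ⟨by simp, .inr ⟨hc, by simp [hb]⟩⟩,
      (represents_wordGraph [b]).of_iso j.symm⟩)

theorem represents_of_mem_language (hG : G.GeneratesStringGraphs) (hnil : [] ∉ G.stringLanguage)
    {H : Hypergraph (G.invSig B M)} (hH : H ∈ (G.invGrammar M f c).language) :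
    ∃ w ∈ invTarget f c, H.Represents (w.map (invLetter G M)) := by
  obtain ⟨hd, ht⟩ := hH
  rcases hd with hd | ⟨gV, gE, -, hlab, -⟩
  · have hinv : Invariant M f c H := by
      clear ht
      induction hd with
      | single h => exact invariant_of_start h
      | tail _ h ih => exact invariant_of_step hG hnil ih h
    rcases hinv with ⟨e, X, he⟩ | ⟨H₀, s, hd, ⟨gV, gE, -, hlab, -⟩, hext⟩ | h
    · obtain ⟨b, hb⟩ := ht e
      cases hb.trans he
    · have hE : H₀.E → False := by
        intro e
        obtain ⟨b, hb⟩ := ht (gE.symm e)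
        cases hb.trans (hlab _).symm
      have hmem : H₀ ∈ G.language := ⟨hd, fun e => (hE e).elim⟩
      obtain ⟨w, hw⟩ := hG _ hmem
      cases w with
      | nil => exact absurd ⟨H₀, hmem, hw⟩ hnil
      | cons a w =>
        obtain ⟨p, q, hp, -⟩ := hw.exists_isPath
        exact (hE (hp.surj 0 (by simp)).choose).elim
    · exact h
  · obtain ⟨b, hb⟩ := ht (gE ())
    cases hb.trans (hlab _)

end Grammar

end PHR

/-! ### Completeness: lifting derivations and inserting erased letters -/

namespace PHR

open PHR.Hypergraph

namespace Hypergraph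

variable {𝒞 : Signature} {H : Hypergraph 𝒞}

/-- Numbers are forced from the start of the path onwards. This makes the represented word unique.
-/
theorem IsPath.node_unique {n n' : ℕ} {p p' : H.V → ℕ} {q q' : H.E → ℕ} (h : H.IsPath n p q)
    (h' : H.IsPath n' p' q') (x : H.V) : p' x = p x := by
  generalize hm : p x = m
  induction m generalizing x with
  | zero =>
    rcases h.cover x with h1 | ⟨e, y, h1⟩
    · exact h'.eq_zero_of_head h1
    · have := h.eq_of_att h1
      omega
  | succ m ih =>
    rcases h.cover x with h1 | ⟨e, y, h1⟩
    · have := h.eq_zero_of_head h1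
      omega
    · have h2 := h.eq_of_att h1
      have h3 := h'.eq_of_att h1
      have := ih y (by omega)
      omega

theorem Represents.unique {v w : List 𝒞.Label} (hv : H.Represents v) (hw : H.Represents w) :
    v = w := by
  obtain ⟨p, q, hp, hlab⟩ := hv.exists_isPath
  obtain ⟨p', q', hp', hlab'⟩ := hw.exists_isPath
  have hq : ∀ e, q' e = q e := by
    intro e
    obtain ⟨x, y, h1, h2, -⟩ := hp.att e
    rw [← h2, ← hp.node_unique hp', (hp'.eq_of_att h1).1]
  have hlen : v.length = w.length := by
    obtain ⟨x, y, h1, -, h2⟩ := hp.ext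
    obtain ⟨x', y', h1', -, h2'⟩ := hp'.ext
    rw [h1] at h1'
    simp only [List.cons.injEq, and_true] at h1'
    rw [← h2, ← h2', ← h1'.2, hp.node_unique hp']
  refine List.ext_getElem? fun i => ?_
  by_cases hi : i < v.length
  · obtain ⟨e, rfl⟩ := hp.surj i hi
    rw [hlab, ← hq, hlab']
  · rw [List.getElem?_eq_none (by omega), List.getElem?_eq_none (by omega)]

theorem map_att_eq_map_ext {σ : H.E → Hypergraph 𝒞} {e : H.E}
    (h : (σ e).type = 𝒞.type (H.lab e)) :
    (H.att e).map (fun x => (Quot.mk _ (Sum.inl x) : (H.replace σ).V)) =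
      (σ e).ext.map fun y => Quot.mk _ (Sum.inr ⟨e, y⟩) := by
  have hlen : (H.att e).length = (σ e).ext.length := (H.length_att e).trans h.symm
  refine List.ext_getElem (by simp [hlen]) fun j h1 h2 => ?_
  rw [List.length_map] at h1 h2
  rw [List.getElem_map, List.getElem_map]
  refine Quot.sound (Glue.glue _ _ _ (List.mem_iff_getElem.2 ⟨j, ?_, ?_⟩))
  · rw [List.length_zip]
    omega
  · simp

end Hypergraph

namespace Grammar

variable {G : Grammar} {B : Type} {M : ℕ} {f : B → List G.sig.Label} {c : Prop}

/-- A run of the transducer: a string of unerased letters is produced while its image is read. -/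
theorem exists_run (hM : ∀ b, (f b).length ≤ M) {w : List B} (hw : ∀ b ∈ w, f b ≠ [])
    {v : List G.sig.Label} {r : G.Pending M} (hr : r.1 ++ w.flatMap f = v) :
    ∃ (st : ℕ → G.Pending M) (U : ℕ → List B), st 0 = r ∧ (st v.length).1 = [] ∧
      (∀ i a, v[i]? = some a →
        (U i).length ≤ 1 ∧ (st i).1 ++ (U i).flatMap f = a :: (st (i + 1)).1) ∧
      (List.range v.length).flatMap U = w := by
  induction v generalizing w r with
  | nil =>
    obtain ⟨h1, h2⟩ := List.append_eq_nil_iff.1 hr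
    have : w = [] := by
      refine List.eq_nil_iff_forall_not_mem.2 fun b hb => hw b hb ?_
      exact List.flatMap_eq_nil_iff.1 h2 b hb
    subst this
    exact ⟨fun _ => r, fun _ => [], rfl, h1, by simp, by simp⟩
  | cons a v ih =>
    -- One letter is read: from the pending string if this is nonempty, and otherwise from the
    -- nonempty image of the next letter of `w`. In both cases the remainder still fits the bound
    -- `M`.
    obtain ⟨u, w', r', rfl, hu, h1, h2⟩ : ∃ (u w' : List B) (r' : G.Pending M), w = u ++ w' ∧
        u.length ≤ 1 ∧ r.1 ++ u.flatMap f = a :: r'.1 ∧ r'.1 ++ w'.flatMap f = v := by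
      obtain ⟨r, hrM⟩ := r
      cases r with
      | nil =>
        cases w with
        | nil => simp at hr
        | cons b w =>
          cases hb : f b with
          | nil => exact absurd hb (hw b (by simp))
          | cons a' r' =>
            have := hM b
            simp only [List.flatMap_cons, List.nil_append, hb, List.cons_append,
              List.cons.injEq] at hr
            rw [hb, List.length_cons] at this
            exact ⟨[b], w, ⟨r', by omega⟩, rfl, le_rfl, by simp [hb, hr.1], hr.2⟩
      | cons a' r' =>
        simp only [List.cons_append, List.cons.injEq] at hr
        rw [List.length_cons] at hrM
        exact ⟨[], w, ⟨r', by omega⟩, rfl, by simp, by simp [hr.1], hr.2⟩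
    obtain ⟨st, U, h3, h4, h5, h6⟩ := ih (fun b hb => hw b (by simp [hb])) h2
    refine ⟨fun i => Nat.casesOn i r st, fun i => Nat.casesOn i u U, rfl, h4, ?_, ?_⟩
    · rintro (_ | i) b hb
      · simp only [List.getElem?_cons_zero, Option.some.injEq] at hb
        subst hb
        exact ⟨hu, h1.trans (by rw [← h3])⟩
      · exact h5 i b hb
    · rw [List.length_cons, List.range_succ_eq_map, List.flatMap_cons, List.flatMap_map, ← h6]
      rfl

variable [Finite B]

/-- States are pulled back from the result along the gluing map, so compatibility at the glued nodes
is automatic. -/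
theorem exists_lift_step {i : G.Index} {H K : Hypergraph G.sig} (h : (G.table i).Step H K)
    (s : K.V → G.Pending M) : ∃ t : H.V → G.Pending M, K.ext.map s = H.ext.map t ∧
      InvStep M f c (decorate B H t) (decorate B K s) := by
  obtain ⟨σ, hσ, gV, gE, hatt, hlab, hext⟩ := h
  have h1 := replace_decorate_iso (B := B) fun z => s (gV z)
  refine ⟨fun x => s (gV (Quot.mk _ (Sum.inl x))), ?_, some i, _, fun e => ?_,
    h1.trans (decorate_iso hatt hlab hext s)⟩
  · rw [← hext, List.map_map]
    exact List.map_map (l := H.ext)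
  · refine LiftRule.lift _ _ _ _ (hσ e) ?_
    have := congrArg (List.map fun z => s (gV z))
      (map_att_eq_map_ext ((G.table i).type_eq _ _ (hσ e)))
    exact (List.map_map (g := fun z => s (gV z))).symm.trans (this.trans List.map_map)

/-- States are known at the end of the derivation and transported backwards. The further step to `N`
absorbs the case where the derivation is a mere isomorphism and has no step of its own. -/
theorem exists_lift_derives {H K : Hypergraph G.sig} (h : G.Derives H K)
    (s : K.V → G.Pending M) : ∃ t : H.V → G.Pending M, K.ext.map s = H.ext.map t ∧
      ∀ N, InvStep M f c (decorate B K s) N →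
        Relation.TransGen (InvStep M f c) (decorate B H t) N := by
  rcases h with h | ⟨gV, gE, hatt, hlab, hext⟩
  · induction h with
    | single h =>
      obtain ⟨i, h⟩ := h
      obtain ⟨t, ht, h⟩ := exists_lift_step (f := f) (c := c) h s
      exact ⟨t, ht, fun N hN => (Relation.TransGen.single h).tail hN⟩
    | tail _ h ih =>
      obtain ⟨i, h⟩ := h
      obtain ⟨t, ht, h⟩ := exists_lift_step (f := f) (c := c) h s
      obtain ⟨t', ht', ih⟩ := ih t
      exact ⟨t', ht.trans ht', fun N hN => (ih _ h).tail hN⟩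
  · refine ⟨fun x => s (gV x), ?_, fun N hN => .single ?_⟩
    · rw [← hext, List.map_map]
      rfl
    · exact hN.of_iso_left (decorate_iso hatt hlab hext s)

variable (M f c) in
/-- The strings represented by derivable hypergraphs. -/
def Reachable (w : List B) : Prop :=
  ∃ H, Relation.TransGen (InvStep M f c) (handle (𝒞 := G.invSig B M) .start) H ∧
    H.Represents (w.map (invLetter G M))

/-- The unerased strings in the preimage of the language of `G` are derivable. -/
theorem reachable_of_forall_ne_nil (hM : ∀ b, (f b).length ≤ M) {w : List B}
    (hw : ∀ b ∈ w, f b ≠ []) (hG : w.flatMap f ∈ G.stringLanguage) : Reachable M f c w := by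
  obtain ⟨H, ⟨hd, ht⟩, hH⟩ := hG
  obtain ⟨st, U, h1, h2, h3, h4⟩ := exists_run hM hw (r := ⟨[], by simp⟩)
    (List.nil_append (w.flatMap f))
  obtain ⟨p, q, hp, hlab⟩ := hH.exists_isPath
  obtain ⟨t, hext, hder⟩ : ∃ t : Fin (G.sig.type G.start) → G.Pending M,
      H.ext.map (fun x => st (p x)) = (List.finRange _).map t ∧
      ∀ N, InvStep M f c (decorate B H fun x => st (p x)) N →
        Relation.TransGen (InvStep M f c) (decorate B (handle G.start) t) N :=
    exists_lift_derives hd fun x => st (p x)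
  have htS : ((List.finRange _).map t).map Subtype.val = [[], []] := by
    obtain ⟨x, y, hxy, hx, hy⟩ := hp.ext
    rw [← hext, hxy]
    simp only [List.map_cons, List.map_nil, hx, hy, h1, h2]
  let s : List.Vector (G.Pending M) (G.sig.type G.start) :=
    ⟨(List.finRange _).map t, by simp⟩
  have hstart : InvStep M f c (handle (𝒞 := G.invSig B M) .start)
      (decorate B (handle G.start) t) := by
    obtain ⟨σ, hσ, j⟩ := Table.step_handle
      (mem_rules_of_commonRule (f := f) (c := c) (CommonRule.start_state s htS) none)
    refine ⟨none, σ, hσ, j.trans ?_⟩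
    have hst : t = s.get := by
      funext i
      rw [List.Vector.get_eq_get_toList]
      simp only [s, List.Vector.toList, List.get_eq_getElem, List.getElem_map,
        List.getElem_finRange]
      rfl
    rw [hst]
    exact handle_state_iso _ s
  let σ : H.E → Hypergraph (G.invSig B M) := fun e => wordGraph G M (U (q e))
  have hfinal : InvStep M f c (decorate B H fun x => st (p x))
      ((decorate B H fun x => st (p x)).replace σ) := by
    refine ⟨none, σ, fun e => ?_, Iso.refl _⟩
    obtain ⟨x, y, hxy, hx, hy⟩ := hp.att e
    obtain ⟨h5, h6⟩ := h3 (q e) _ (hlab e)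
    refine FinalRule.final _ _ (st (q e)) (st (q e + 1)) _ (ht e) ?_ h5 h6
    refine (congrArg (List.map _) hxy).trans ?_
    simp [hx, hy]
  refine ⟨_, .head hstart (hder _ hfinal), ?_⟩
  have hp' : (decorate B H fun x => st (p x)).IsPath (w.flatMap f).length p q :=
    ⟨hp.inj, hp.lt, hp.surj, hp.att, hp.ext, hp.cover⟩
  rw [← h4, List.map_flatMap]
  exact hp'.represents_replace (U := fun i => (U i).map (invLetter G M))
    fun e => represents_wordGraph _

/-- A letter of a derivable string may be rewritten. -/
theorem Reachable.rewrite {x z u : List B} {b : B} (h : Reachable M f c (x ++ b :: z))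
    (h0 : u ≠ []) (h2 : u.length ≤ 2) (hu : u.flatMap f = f b) :
    Reachable M f c (x ++ u ++ z) := by
  obtain ⟨H, hH, hw⟩ := h
  obtain ⟨p, q, hp, hlab⟩ := hw.exists_isPath
  -- Parallelism forces every letter to be replaced; all but the chosen one are replaced by
  -- themselves.
  let us : List (List B) := x.map (fun a => [a]) ++ u :: z.map fun a => [a]
  have hus : List.Forall₂ (fun a v => v ≠ [] ∧ v.length ≤ 2 ∧ v.flatMap f = f a)
      (x ++ b :: z) us := by
    have hone : ∀ y : List B, List.Forall₂ (fun a v => v ≠ [] ∧ v.length ≤ 2 ∧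
        v.flatMap f = f a) y (y.map fun a => [a]) := by
      intro y
      rw [List.forall₂_map_right_iff]
      exact List.forall₂_same.2 fun a _ => by simp
    exact List.rel_append (hone x) (.cons ⟨h0, h2, hu⟩ (hone z))
  have hlen := hus.length_eq
  let U : ℕ → List B := fun i => us.getD i []
  let σ : H.E → Hypergraph (G.invSig B M) := fun e => wordGraph G M (U (q e))
  refine ⟨H.replace σ, hH.tail ⟨none, σ, fun e => mem_rules_of_commonRule ?_ _, Iso.refl _⟩, ?_⟩
  · have h1 := hlab e
    rw [List.getElem?_map] at h1
    obtain ⟨a, ha, hae⟩ := Option.map_eq_some_iff.1 h1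
    obtain ⟨hi, ha⟩ := List.getElem?_eq_some_iff.1 ha
    have h3 := hus.get hi (by omega)
    rw [List.get_eq_getElem, List.get_eq_getElem, ha] at h3
    have hUi : U (q e) = us[q e]'(by omega) := by
      simp only [U]
      rw [List.getD_eq_getElem]
    rw [← hae]
    change CommonRule f c (.letter a) (wordGraph G M (U (q e)))
    rw [hUi]
    exact .letter a _ h3.1 h3.2.1 h3.2.2
  · have : x ++ u ++ z = (List.range (x ++ b :: z).length).flatMap U := by
      rw [hlen, flatMap_range_getD]
      simp [us, ← List.flatMap_def]
    rw [this, List.map_flatMap]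
    rw [List.length_map] at hp
    exact hp.represents_replace (U := fun i => (U i).map (invLetter G M))
      fun e => represents_wordGraph _

/-- An erased letter is removed, and after induction it is reinserted by rewriting a neighbour `d`,
on whichever side there is one. -/
theorem reachable_of_mem_invTarget (hM : ∀ b, (f b).length ≤ M) (hnil : [] ∉ G.stringLanguage) (n : ℕ)
    {w : List B}
    (hn : w.length = n) (hw : w ∈ invTarget f c) : Reachable M f c w := by
  induction n generalizing w with
  | zero => exact absurd (List.length_eq_zero_iff.1 hn) hw.1
  | succ n ih =>
    by_cases hall : ∀ b ∈ w, f b ≠ []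
    · rcases hw.2 with h | ⟨-, h⟩
      · exact reachable_of_forall_ne_nil hM hall h
      · obtain ⟨b, hb⟩ := List.exists_mem_of_ne_nil w hw.1
        exact absurd (List.flatMap_eq_nil_iff.1 h b hb) (hall b hb)
    push Not at hall
    obtain ⟨b, hb, hfb⟩ := hall
    obtain ⟨x, z, rfl⟩ := List.append_of_mem hb
    have hf : (x ++ b :: z).flatMap f = (x ++ z).flatMap f := by simp [hfb]
    have hlen : (x ++ z).length = n := by
      simp only [List.length_append, List.length_cons] at hn ⊢
      omega
    rcases z with _ | ⟨d, z⟩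
    · rcases List.eq_nil_or_concat x with rfl | ⟨x, d, rfl⟩
      · have hb : [b].flatMap f = [] := by simp [hfb]
        -- The word is a single erased letter without neighbour. Its image is empty and so not in
        -- the old string language, which leaves only the case `c`.
        have hc : c := by
          rcases hw.2 with h | h
          · rw [List.nil_append, hb] at h
            exact absurd h hnil
          · exact h.1
        exact ⟨_, .single ⟨none, Table.step_handle (mem_rules_of_commonRule
          (CommonRule.start_letter b hc hfb) none)⟩, represents_wordGraph [b]⟩
      · have h1 : Reachable M f c (x ++ d :: []) := by
          refine ih (by simpa using hlen) ⟨by simp, ?_⟩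
          have := hw.2
          rw [hf] at this
          simpa using this
        have := h1.rewrite (u := [d, b]) (by simp) (by simp) (by simp [hfb])
        simpa using this
    · have h1 : Reachable M f c (x ++ d :: z) := by
        refine ih hlen ⟨by simp, ?_⟩
        rw [← hf]
        exact hw.2
      have := h1.rewrite (u := [b, d]) (by simp) (by simp) (by simp [hfb])
      simpa using this

theorem generatesStringGraphs_invGrammar (hG : G.GeneratesStringGraphs)
    (hnil : [] ∉ G.stringLanguage) : (G.invGrammar M f c).GeneratesStringGraphs :=
  fun _ hH =>
    let ⟨_, _, h⟩ := represents_of_mem_language hG hnil hH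
    ⟨_, h⟩

theorem stringLanguage_invGrammar (hM : ∀ b, (f b).length ≤ M) (hG : G.GeneratesStringGraphs)
    (hnil : [] ∉ G.stringLanguage) :
    (G.invGrammar M f c).stringLanguage = List.map (invLetter G M) '' invTarget f c := by
  ext w
  constructor
  · rintro ⟨H, hH, hw⟩
    obtain ⟨v, hv, hHv⟩ := represents_of_mem_language hG hnil hH
    exact ⟨v, hv, hHv.unique hw⟩
  · rintro ⟨v, hv, rfl⟩
    obtain ⟨H, hH, hw⟩ := reachable_of_mem_invTarget hM hnil _ rfl hv
    refine ⟨H, ⟨.inl hH, fun e => ?_⟩, hw⟩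
    obtain ⟨p, q, -, hlab⟩ := hw.exists_isPath
    obtain ⟨b, -, hb⟩ := List.mem_map.1 (List.mem_of_getElem? (hlab e))
    exact ⟨b, hb⟩

theorem orderLE_invGrammar {k : ℕ} (hk : 2 ≤ k) (hG : G.OrderLE k) :
    (G.invGrammar M f c).OrderLE k := by
  -- Tables are total and there is at least one, so the bound on rules bounds the types of all
  -- labels.
  have hX : ∀ X, G.sig.type X ≤ k := by
    intro X
    obtain ⟨i⟩ := G.nonemptyIndex
    obtain ⟨R, hR⟩ := (G.table i).total X
    exact hG i _ hR
  rintro i ⟨_ | (_ | X) | ⟨X, s⟩ | b, R⟩ -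
  · exact hk
  · exact hk
  · exact hX X
  · exact hX X
  · exact hk

end Grammar

end PHR

/-! ### The closure theorem -/

theorem mainTheorem9 {A B : Type*} [Finite A] [Finite B] (k : ℕ) (hk : 2 ≤ k)
    (φ : FreeMonoid B →* FreeMonoid A) (L : Language A) (hL : PHR.IsPHRS k L) :
    PHR.IsPHRS k (PHR.inverseImage φ L) := by
  obtain ⟨-, -, G, ι, hk', -, hG, hL⟩ := hL
  -- Labels of a signature live in `Type`, whereas `B` may lie in any universe; `Fin n` takes its
  -- place.
  obtain ⟨n, ⟨e⟩⟩ := Finite.exists_equiv_fin B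
  let g : B → List A := fun b => FreeMonoid.toList (φ (FreeMonoid.of b))
  have hg : ∀ w : List B, FreeMonoid.toList (φ (FreeMonoid.ofList w)) = w.flatMap g := by
    intro w
    induction w with
    | nil => simp
    | cons b w ih => rw [FreeMonoid.ofList_cons, map_mul, FreeMonoid.toList_mul, ih,
        List.flatMap_cons]
  let f : Fin n → List G.sig.Label := fun b => (g (e.symm b)).map ι
  have hf : ∀ w : List B, (w.map e).flatMap f = (w.flatMap g).map ι := by
    intro w
    simp [f, List.flatMap_map, List.map_flatMap]
  have hιinj : Function.Injective (List.map ι) := List.map_injective_iff.2 ι.injective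
  have hnil : [] ∉ G.stringLanguage := by
    rw [hL]
    rintro ⟨w, hw, h⟩
    exact hw.2 (List.map_eq_nil_iff.1 h)
  obtain ⟨M, hM⟩ : ∃ M, ∀ b, (f b).length ≤ M := by
    obtain ⟨M, hM⟩ := (Set.finite_range fun b => (f b).length).bddAbove
    exact ⟨M, fun b => hM ⟨b, rfl⟩⟩
  -- The old grammar generates only nonempty words, so `[] ∈ L` is taken as `c` to account for the
  -- nonempty words with empty image.
  have htarget : ∀ w : List B, w.map e ∈ PHR.Grammar.invTarget f ([] ∈ L) ↔
      w ∈ PHR.inverseImage φ L ∧ w ≠ [] := by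
    intro w
    have h1 : w ∈ PHR.inverseImage φ L ↔ w.flatMap g ∈ L := by
      rw [← hg]
      rfl
    have h2 : (w.flatMap g).map ι ∈ G.stringLanguage ↔ w.flatMap g ∈ L ∧ w.flatMap g ≠ [] := by
      rw [hL]
      exact hιinj.mem_set_image
    rw [h1, PHR.Grammar.invTarget, Set.mem_ofPred_eq, hf, h2, Ne, List.map_eq_nil_iff,
      List.map_eq_nil_iff, and_comm]
    refine and_congr_left fun _ => ?_
    by_cases h : w.flatMap g = []
    · simp [h]
    · simp [h]
  refine ⟨(Set.range (G.invGrammar M f ([] ∈ L)).table).ncard, ?_, G.invGrammar M f ([] ∈ L),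
    ⟨fun b => PHR.Grammar.invLetter G M (e b), fun a b h => e.injective ?_⟩,
    PHR.Grammar.orderLE_invGrammar hk hk', le_rfl,
    PHR.Grammar.generatesStringGraphs_invGrammar hG hnil, ?_⟩
  · exact (Set.ncard_pos (Set.finite_range _)).2 (Set.range_nonempty _)
  · exact PHR.Grammar.InvLabel.letter.inj h
  · rw [PHR.Grammar.stringLanguage_invGrammar hM hG hnil]
    ext w
    constructor
    · rintro ⟨v, hv, rfl⟩
      have hve : (v.map e.symm).map e = v := by simp
      refine ⟨v.map e.symm, (htarget _).1 (hve.symm ▸ hv), ?_⟩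
      rw [List.map_map]
      exact List.map_congr_left fun b _ => congrArg _ (e.apply_symm_apply b)
    · rintro ⟨v, hv, rfl⟩
      exact ⟨v.map e, (htarget v).2 hv, List.map_map⟩
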